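/- Let $F\in\mathbb C[x_0,x_1,x_2]$ be a homogeneous polynomial of degree $d>1$ that defines a smooth plane curve, i.e. at every $v\in\mathbb C^3\setminus\{0\}$ with $F(v)=0$ some partial derivative of $F$ is nonzero. Let $C$ be the smooth curve $\{F=0\}\subset\mathbb P^2$, that is, a Riemann surface $C$ with a holomorphic embedding $\iota:C\hookrightarrow\mathbb P^2$ whose image is $\{F=0\}$. A holomorphic line field along $C$ is a holomorphic line subbundle $Y$ of the restriction $T\mathbb P^2|_C$; it is transverse to $C$ if $Y_p\neq T_pC$ for every $p\in C$, i.e. if the morphism of line bundles $Y\to N_C=T\mathbb P^2|_C/TC$ has no zero. Then there is no holomorphic line field along $C$ that is transverse to $C$. -/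

import Mathlib

open Topology
open scoped Manifold ContDiff LinearAlgebra.Projectivization

noncomputable section

/-! ### Complex projective space as a complex manifold -/

/-- Complex projective `n`-space, the set of lines through the origin of `ℂ^(n+1)`. -/
abbrev CProj (n : ℕ) : Type := ℙ ℂ (Fin (n + 1) → ℂ)

namespace CProj

variable {n : ℕ}

/-- The quotient topology. -/
instance instTopologicalSpace : TopologicalSpace (CProj n) :=
  inferInstanceAs (TopologicalSpace
    (Quotient (projectivizationSetoid ℂ (Fin (n + 1) → ℂ))))

theorem isQuotientMap_mk' :
    IsQuotientMap (Projectivization.mk' ℂ : {v : Fin (n + 1) → ℂ // v ≠ 0} → CProj n) :=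
  isQuotientMap_quot_mk

/-- The affine piece `{[z₀ : ⋯ : zₙ] | zᵢ ≠ 0}`. -/
def affineSet (i : Fin (n + 1)) : Set (CProj n) :=
  {p | Projectivization.lift (fun v : {v : Fin (n + 1) → ℂ // v ≠ 0} => v.1 i ≠ 0)
    (by
      rintro ⟨a, ha⟩ ⟨b, hb⟩ t h
      have ht : t ≠ 0 := by rintro rfl; exact ha (by simpa using h)
      simp only at h
      simp [h, ht]) p}

/-- The affine coordinates `[z₀ : ⋯ : zₙ] ↦ (zⱼ / zᵢ)_{j ≠ i}`. -/
def affineCoord (i : Fin (n + 1)) (p : CProj n) : Fin n → ℂ :=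
  Projectivization.lift
    (fun (v : {v : Fin (n + 1) → ℂ // v ≠ 0}) (j : Fin n) => v.1 (i.succAbove j) / v.1 i)
    (by
      rintro ⟨a, ha⟩ ⟨b, hb⟩ t h
      have ht : t ≠ 0 := by rintro rfl; exact ha (by simpa using h)
      simp only at h
      funext j
      simp [h, mul_div_mul_left _ _ ht]) p

@[simp] theorem mk_mem_affineSet (i : Fin (n + 1)) (v : Fin (n + 1) → ℂ) (hv : v ≠ 0) :
    (Projectivization.mk ℂ v hv : CProj n) ∈ affineSet i ↔ v i ≠ 0 := Iff.rfl

@[simp] theorem affineCoord_mk (i : Fin (n + 1)) (v : Fin (n + 1) → ℂ) (hv : v ≠ 0) :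
    affineCoord i (Projectivization.mk ℂ v hv) = fun j => v (i.succAbove j) / v i := rfl

/-- The vector with `1` in position `i` and the entries of `w` in the other positions. -/
def affineLift (i : Fin (n + 1)) (w : Fin n → ℂ) : Fin (n + 1) → ℂ :=
  i.insertNth (α := fun _ => ℂ) 1 w

@[simp] theorem affineLift_same (i : Fin (n + 1)) (w : Fin n → ℂ) : affineLift i w i = 1 := by
  simp [affineLift]

@[simp] theorem affineLift_succAbove (i : Fin (n + 1)) (w : Fin n → ℂ) (j : Fin n) :
    affineLift i w (i.succAbove j) = w j := by
  simp [affineLift]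

theorem affineLift_ne_zero (i : Fin (n + 1)) (w : Fin n → ℂ) : affineLift i w ≠ 0 := fun h => by
  simpa using congrFun h i

theorem contDiff_affineLift (i : Fin (n + 1)) : ContDiff ℂ ω (affineLift (n := n) i) := by
  rw [contDiff_pi]
  intro k
  rcases Fin.eq_self_or_eq_succAbove i k with rfl | ⟨j, rfl⟩
  · simpa using contDiff_const
  · simpa using contDiff_apply ℂ ℂ j

theorem isOpen_affineSet (i : Fin (n + 1)) : IsOpen (affineSet i : Set (CProj n)) := by
  rw [← isQuotientMap_mk'.isOpen_preimage]
  exact isOpen_ne_fun ((continuous_apply i).comp continuous_subtype_val) continuous_const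

/-- The standard affine chart of projective space on `{zᵢ ≠ 0}`. -/
def affineChart (i : Fin (n + 1)) : OpenPartialHomeomorph (CProj n) (Fin n → ℂ) where
  toFun := affineCoord i
  invFun w := Projectivization.mk ℂ (affineLift i w) (affineLift_ne_zero i w)
  source := affineSet i
  target := Set.univ
  map_source' _ _ := Set.mem_univ _
  map_target' w _ := by simp
  left_inv' p hp := by
    induction p using Projectivization.ind with | h v hv =>
    rw [mk_mem_affineSet] at hp
    rw [Projectivization.mk_eq_mk_iff']
    refine ⟨(v i)⁻¹, funext fun k => ?_⟩
    rcases Fin.eq_self_or_eq_succAbove i k with rfl | ⟨j, rfl⟩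
    · simp [hp]
    · simp [div_eq_inv_mul]
  right_inv' w _ := by
    funext j
    simp
  open_source := isOpen_affineSet i
  open_target := isOpen_univ
  continuousOn_toFun := by
    rw [isQuotientMap_mk'.continuousOn_isOpen_iff (isOpen_affineSet i)]
    refine continuousOn_pi.2 fun j => ContinuousOn.div ?_ ?_ fun v hv => hv
    · exact ((continuous_apply _).comp continuous_subtype_val).continuousOn
    · exact ((continuous_apply _).comp continuous_subtype_val).continuousOn
  continuousOn_invFun := by
    refine Continuous.continuousOn (isQuotientMap_mk'.continuous.comp
      (f := fun w => (⟨affineLift i w, affineLift_ne_zero i w⟩ : {v : Fin (n + 1) → ℂ // v ≠ 0})) ?_)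
    exact (contDiff_affineLift i).continuous.subtype_mk _

theorem exists_mem_affineSet (p : CProj n) : ∃ i, p ∈ affineSet i := by
  induction p using Projectivization.ind with | h v hv =>
  exact Function.ne_iff.1 hv

/-- The atlas of the standard affine charts. -/
instance instChartedSpace : ChartedSpace (Fin n → ℂ) (CProj n) where
  atlas := Set.range affineChart
  chartAt p := affineChart (exists_mem_affineSet p).choose
  mem_chart_source p := (exists_mem_affineSet p).choose_spec
  chart_mem_atlas _ := Set.mem_range_self _

/-- Projective `n`-space is a complex manifold of dimension `n`. -/
instance instIsManifold : IsManifold 𝓘(ℂ, Fin n → ℂ) ω (CProj n) := by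
  apply isManifold_of_contDiffOn
  rintro _ _ ⟨i, rfl⟩ ⟨k, rfl⟩
  have h : ContDiffOn ℂ ω (fun (w : Fin n → ℂ) (j : Fin n) =>
      affineLift i w (k.succAbove j) / affineLift i w k) {w | affineLift i w k ≠ 0} := by
    rw [contDiffOn_pi]
    intro j
    have hc := fun l => ((contDiff_apply ℂ ℂ l).comp (contDiff_affineLift (n := n) i)).contDiffOn
      (s := {w | affineLift i w k ≠ 0})
    exact (hc _).div (hc _) fun w hw => hw
  refine h.mono ?_
  rintro w ⟨⟨-, hw⟩, -⟩
  exact hw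

end CProj

/-! ### Line fields along a curve in a complex surface -/

section LineField

variable {C : Type*} [TopologicalSpace C] [ChartedSpace ℂ C]
  (E : Type*) [NormedAddCommGroup E] [NormedSpace ℂ E]
  {S : Type*} [TopologicalSpace S] [ChartedSpace E S] [IsManifold 𝓘(ℂ, E) ω S]

/-- A holomorphic line field along a holomorphic curve `ι : C → S`: a holomorphic subbundle of
rank one of the restriction to `C` of the tangent bundle of `S`. Near every point of `C` it is
spanned by a holomorphic section of `TS` over `C` that has no zero. -/
structure HolomorphicLineField (ι : C → S) where
  /-- The line in `T_{ι x} S` at the point `x` of `C`. -/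
  line : ∀ x : C, Submodule ℂ (TangentSpace 𝓘(ℂ, E) (ι x))
  exists_local_generator : ∀ x₀ : C, ∃ U : Set C, IsOpen U ∧ x₀ ∈ U ∧
    ∃ v : ∀ x : C, TangentSpace 𝓘(ℂ, E) (ι x),
      ContMDiffOn 𝓘(ℂ) 𝓘(ℂ, E).tangent ω
        (fun x => (⟨ι x, v x⟩ : TangentBundle 𝓘(ℂ, E) S)) U ∧
      ∀ x ∈ U, v x ≠ 0 ∧ line x = Submodule.span ℂ {v x}

/-- The tangent line of the curve, as a subspace of the tangent space of the surface. -/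
def curveTangentLine (ι : C → S) (x : C) : Submodule ℂ (TangentSpace 𝓘(ℂ, E) (ι x)) :=
  (mfderiv 𝓘(ℂ) 𝓘(ℂ, E) ι x : TangentSpace 𝓘(ℂ) x →L[ℂ] TangentSpace 𝓘(ℂ, E) (ι x)).range

variable {E}

/-- The line field is tangent to the curve at `x`: the morphism from the line field to the
normal bundle `TS|_C / TC` vanishes at `x`. -/
def HolomorphicLineField.IsTangentAt {ι : C → S} (Y : HolomorphicLineField E ι) (x : C) : Prop :=
  Y.line x ≤ curveTangentLine E ι x

/-- A line field along the curve is transverse to it if it is nowhere tangent to it. -/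
def HolomorphicLineField.IsTransverse {ι : C → S} (Y : HolomorphicLineField E ι) : Prop :=
  ∀ x : C, ¬ Y.IsTangentAt x

end LineField

/-! ### Smooth plane curves -/

/-- The set of zeros in the projective plane of a homogeneous polynomial in three variables. -/
def planeCurve (F : MvPolynomial (Fin 3) ℂ) : Set (CProj 2) :=
  {p | ∀ v ∈ p.submodule, MvPolynomial.eval v F = 0}

/-- `F` is a homogeneous polynomial of degree `d` that defines a smooth plane curve: at every point
of the curve some partial derivative of `F` is not zero. -/
structure IsSmoothPlaneCurveEquation (F : MvPolynomial (Fin 3) ℂ) (d : ℕ) : Prop where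
  isHomogeneous : F.IsHomogeneous d
  smooth : ∀ v : Fin 3 → ℂ, v ≠ 0 → MvPolynomial.eval v F = 0 →
    ∃ i, MvPolynomial.eval v (MvPolynomial.pderiv i F) ≠ 0

end

section PlaneCurveLineField

open MvPolynomial Matrix

/-! ### Homogeneous polynomials in three variables -/

/-! Suppose that Y is transverse. Let z represent a point p of C and let a represent the direction
Y_p; a is determined up to scaling and modulo z. The cross product z × a is the covector of the
projective line through p in the direction Y_p. Transversality and smoothness give dF_z(a) ≠ 0
(`polar_ne_zero_of_not_mem`), so ℓ = (z × a) / dF_z(a) makes sense. On the curve Euler's identity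
gives dF_z(z) = 0, hence ℓ does not depend on the choice of a and is homogeneous of degree 2 - d in
z (`normalizedLine_smul`).

Since d > 1, the product z_j^(d-2) ℓ has no poles: it is a holomorphic map from C to ℂ³
(`HolomorphicLineField.mdifferentiable_covector`), and it is locally constant because C is compact.
Choose j with z_j ≠ 0 at p. Near p all points of C then lie on one fixed line, and differentiating ℓ
· z = 0 with ℓ constant puts the velocity of C at p on that line. So Y_p = T_pC, a contradiction. -/

theorem MvPolynomial.IsHomogeneous.eval_smul {σ : Type*} {F : MvPolynomial σ ℂ} {d : ℕ}
    (hF : F.IsHomogeneous d) (t : ℂ) (v : σ → ℂ) : eval (t • v) F = t ^ d * eval v F := by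
  rw [eval_eq, eval_eq, Finset.mul_sum]
  refine Finset.sum_congr rfl fun m hm => ?_
  have h : ∑ i ∈ m.support, m i = d := by
    have := hF (mem_support_iff.1 hm)
    simpa [Finsupp.weight_apply, Finsupp.sum] using this
  simp only [Pi.smul_apply, smul_eq_mul, mul_pow, Finset.prod_mul_distrib]
  rw [Finset.prod_pow_eq_pow_sum, h]; ring

theorem MvPolynomial.contDiff_eval {σ : Type*} [Fintype σ] (F : MvPolynomial σ ℂ) {n : ℕ∞ω} :
    ContDiff ℂ n (fun w : σ → ℂ => eval w F) := by
  induction F using MvPolynomial.induction_on with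
  | C a => simpa using contDiff_const
  | add p q hp hq => simpa using hp.add hq
  | mul_X p j hp => simpa using hp.mul (contDiff_apply ℂ ℂ j)

/-- A homogeneous polynomial of positive degree in three variables over `ℂ` has a nontrivial
zero. -/
theorem MvPolynomial.IsHomogeneous.exists_eval_eq_zero {F : MvPolynomial (Fin 3) ℂ} {d : ℕ}
    (hF : F.IsHomogeneous d) (hd : d ≠ 0) : ∃ v : Fin 3 → ℂ, v ≠ 0 ∧ eval v F = 0 := by
  let p : Polynomial ℂ := MvPolynomial.aeval ![Polynomial.X, 1, 0] F
  have hp (t : ℂ) : p.eval t = eval ![t, 1, 0] F := by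
    have : (Polynomial.evalRingHom t).comp
        (MvPolynomial.aeval ![Polynomial.X, 1, 0]).toRingHom
        = eval ![t, 1, 0] := by
      ext i
      · simp
      · fin_cases i <;> simp
    exact congrArg (· F) this
  -- Degree 0 means a nonzero constant c, as the zero polynomial has degree `⊥`. In that case F(1,
  -- s, 0) = s^d c for s ≠ 0, and by continuity [1 : 0 : 0] is a zero.
  by_cases hdeg : p.degree = 0
  · rw [Polynomial.eq_C_of_degree_eq_zero hdeg] at hp
    simp only [Polynomial.eval_C] at hp
    set c := p.coeff 0
    have h1 (s : ℂ) (hs : s ≠ 0) : eval ![1, s, 0] F = s ^ d * c := by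
      rw [hp s⁻¹, ← hF.eval_smul]
      congr 2
      funext i
      fin_cases i <;> simp [hs]
    have hcont : Continuous fun s : ℂ => eval ![1, s, 0] F := by
      refine (contDiff_eval F (n := 0)).continuous.comp (continuous_pi fun i => ?_)
      fin_cases i <;> simp <;> fun_prop
    have h2 : (fun s : ℂ => eval ![1, s, 0] F) = fun s => s ^ d * c :=
      hcont.ext_on (dense_compl_singleton (0 : ℂ)) (by fun_prop) fun s hs => h1 s hs
    refine ⟨![1, 0, 0], fun h => by simpa using congrFun h 0, ?_⟩
    simpa [hd] using congrFun h2 0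
  · obtain ⟨t, ht⟩ := IsAlgClosed.exists_root p hdeg
    exact ⟨![t, 1, 0], fun h => by simpa using congrFun h 1, by rw [← hp]; exact ht⟩

/-! ### Directional derivatives of the equation and normalised lines -/

/-- The derivative of `F` at `z` in the direction `a`. -/
noncomputable def polar (F : MvPolynomial (Fin 3) ℂ) (z a : Fin 3 → ℂ) : ℂ :=
  ∑ i, eval z (pderiv i F) * a i

theorem polar_add_smul (F : MvPolynomial (Fin 3) ℂ) (z a b : Fin 3 → ℂ) (s c : ℂ) :
    polar F z (s • a + c • b) = s * polar F z a + c * polar F z b := by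
  simp only [polar, Finset.mul_sum, ← Finset.sum_add_distrib]
  exact Finset.sum_congr rfl fun i _ => by simp; ring

theorem polar_smul_left {F : MvPolynomial (Fin 3) ℂ} {d : ℕ} (hF : F.IsHomogeneous d) (t : ℂ)
    (z a : Fin 3 → ℂ) : polar F (t • z) a = t ^ (d - 1) * polar F z a := by
  simp only [polar, Finset.mul_sum]
  exact Finset.sum_congr rfl fun i _ => by rw [hF.pderiv.eval_smul]; ring

/-- Euler's identity. On the curve it puts z in the kernel of dF_z, so dF_z is well defined on
directions modulo z. -/
theorem polar_self {F : MvPolynomial (Fin 3) ℂ} {d : ℕ} (hF : F.IsHomogeneous d)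
    (z : Fin 3 → ℂ) : polar F z z = d * eval z F := by
  have := congrArg (eval z) hF.sum_X_mul_pderiv
  simpa [polar, mul_comm] using this

theorem contDiff_polar (F : MvPolynomial (Fin 3) ℂ) {n : ℕ∞ω} :
    ContDiff ℂ n (fun q : (Fin 3 → ℂ) × (Fin 3 → ℂ) => polar F q.1 q.2) := by
  unfold polar
  refine ContDiff.sum fun i _ => ?_
  exact ((contDiff_eval _).comp contDiff_fst).mul ((contDiff_apply ℂ ℂ i).comp contDiff_snd)

theorem hasDerivAt_eval (F : MvPolynomial (Fin 3) ℂ) {c : ℂ → Fin 3 → ℂ} {t : ℂ}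
    {b : Fin 3 → ℂ} (hc : HasDerivAt c b t) :
    HasDerivAt (fun s => eval (c s) F) (polar F (c t) b) t := by
  unfold polar
  induction F using MvPolynomial.induction_on with
  | C a => simpa using hasDerivAt_const t a
  | add p q hp hq =>
    simp only [map_add, add_mul, Finset.sum_add_distrib]
    exact hp.add hq
  | mul_X p j hp =>
    have h := hp.mul (hasDerivAt_pi.1 hc j)
    simp only [eval_mul, eval_X]
    refine h.congr_deriv ?_
    simp [pderiv_X, Pi.single_apply, Finset.sum_add_distrib, add_mul, Finset.sum_mul, apply_ite]
    rw [add_comm]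
    congr 1
    exact Finset.sum_congr rfl fun i _ => by ring

/-- The line through `z` in the direction `a`, as a covector normalised by `F`. -/
noncomputable def normalizedLine (F : MvPolynomial (Fin 3) ℂ) (z a : Fin 3 → ℂ) : Fin 3 → ℂ :=
  (polar F z a)⁻¹ • (z ⨯₃ a)

/-- The cross product scales by t s and, by Euler's identity on the curve, the denominator scales by
t^(d-1) s; both s and c drop out of the quotient. The bound on d makes the truncated exponent d - 2
the true one. -/
theorem normalizedLine_smul {F : MvPolynomial (Fin 3) ℂ} {d : ℕ} (hF : F.IsHomogeneous d)
    (hd : 1 < d) {z a : Fin 3 → ℂ} (hz : eval z F = 0) {t s : ℂ} (ht : t ≠ 0) (hs : s ≠ 0)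
    (c : ℂ) : t ^ (d - 2) • normalizedLine F (t • z) (s • a + c • z) = normalizedLine F z a := by
  obtain ⟨e, rfl⟩ : ∃ e, d = e + 2 := ⟨d - 2, by omega⟩
  have h1 : polar F (t • z) (s • a + c • z) = t ^ (e + 1) * (s * polar F z a) := by
    rw [polar_smul_left hF, polar_add_smul, polar_self hF, hz]
    simp
  have h2 : (t • z) ⨯₃ (s • a + c • z) = (t * s) • (z ⨯₃ a) := by
    simp [mul_smul, cross_self]
  rw [normalizedLine, normalizedLine, h1, h2, smul_smul, smul_smul]
  congr 1
  simp only [Nat.add_sub_cancel]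
  -- With the convention 0⁻¹ = 0 both sides vanish.
  by_cases hp : polar F z a = 0
  · simp [hp]
  · field_simp
    ring

theorem contDiffAt_normalizedLine (F : MvPolynomial (Fin 3) ℂ) {n : ℕ∞ω} {z a : Fin 3 → ℂ}
    (h : polar F z a ≠ 0) :
    ContDiffAt ℂ n (fun q : (Fin 3 → ℂ) × (Fin 3 → ℂ) => normalizedLine F q.1 q.2) (z, a) := by
  have h1 (i : Fin 3) : ContDiff ℂ n fun q : (Fin 3 → ℂ) × (Fin 3 → ℂ) => q.1 i :=
    (contDiff_apply ℂ ℂ i).comp contDiff_fst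
  have h2 (i : Fin 3) : ContDiff ℂ n fun q : (Fin 3 → ℂ) × (Fin 3 → ℂ) => q.2 i :=
    (contDiff_apply ℂ ℂ i).comp contDiff_snd
  have h3 : ContDiffAt ℂ n (fun q : (Fin 3 → ℂ) × (Fin 3 → ℂ) => (polar F q.1 q.2)⁻¹) (z, a) :=
    ContDiffAt.inv (contDiff_polar F).contDiffAt h
  refine contDiffAt_pi.2 fun i => ?_
  simp only [normalizedLine, Pi.smul_apply, smul_eq_mul, cross_apply]
  refine h3.mul (ContDiff.contDiffAt ?_)
  fin_cases i
  exacts [((h1 1).mul (h2 2)).sub ((h1 2).mul (h2 1)), ((h1 2).mul (h2 0)).sub ((h1 0).mul (h2 2)),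
    ((h1 0).mul (h2 1)).sub ((h1 1).mul (h2 0))]

theorem normalizedLine_dotProduct (F : MvPolynomial (Fin 3) ℂ) (z a : Fin 3 → ℂ) :
    normalizedLine F z a ⬝ᵥ z = 0 := by
  rw [normalizedLine, smul_dotProduct, dotProduct_comm, dot_self_cross, smul_zero]

/-! ### Affine charts -/

namespace CProj

variable {n : ℕ}

/-- The linear part of `affineLift`. -/
noncomputable def affineLin (i : Fin (n + 1)) : (Fin n → ℂ) →L[ℂ] (Fin (n + 1) → ℂ) :=
  LinearMap.toContinuousLinearMap
    { toFun := fun w => i.insertNth (α := fun _ => ℂ) 0 w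
      map_add' := fun v w => by
        funext k
        rcases Fin.eq_self_or_eq_succAbove i k with rfl | ⟨j, rfl⟩ <;> simp
      map_smul' := fun c w => by
        funext k
        rcases Fin.eq_self_or_eq_succAbove i k with rfl | ⟨j, rfl⟩ <;> simp }

@[simp] theorem affineLin_same (i : Fin (n + 1)) (w : Fin n → ℂ) : affineLin i w i = 0 := by
  simp [affineLin]

@[simp] theorem affineLin_succAbove (i : Fin (n + 1)) (w : Fin n → ℂ) (j : Fin n) :
    affineLin i w (i.succAbove j) = w j := by
  simp [affineLin]

theorem affineLift_eq (i : Fin (n + 1)) (w : Fin n → ℂ) :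
    affineLift i w = affineLin i w + affineLift i 0 := by
  funext k
  rcases Fin.eq_self_or_eq_succAbove i k with rfl | ⟨j, rfl⟩ <;> simp

theorem hasFDerivAt_affineLift (i : Fin (n + 1)) (w : Fin n → ℂ) :
    HasFDerivAt (affineLift i) (affineLin i) w := by
  have : affineLift i = fun w => affineLin i w + affineLift i 0 := funext (affineLift_eq i)
  rw [this]
  exact (affineLin i).hasFDerivAt.add_const _

theorem mk_affineLift_affineCoord (i : Fin (n + 1)) {p : CProj n} (hp : p ∈ affineSet i) :
    Projectivization.mk ℂ (affineLift i (affineCoord i p)) (affineLift_ne_zero i _) = p :=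
  (affineChart i).left_inv hp

/-- The affine lift of an affine coordinate change is the affine lift rescaled. -/
theorem affineLift_affineCoord_mk (k : Fin (n + 1)) (v : Fin (n + 1) → ℂ) (hv : v ≠ 0)
    (hk : v k ≠ 0) :
    affineLift k (affineCoord k (Projectivization.mk ℂ v hv)) = (v k)⁻¹ • v := by
  funext l
  rcases Fin.eq_self_or_eq_succAbove k l with rfl | ⟨j, rfl⟩
  · simp [hk]
  · simp [div_eq_inv_mul]

/-- The derivative of an affine coordinate change in homogeneous coordinates. -/
theorem affineLin_fderiv_coordChange (i k : Fin (n + 1)) (w v : Fin n → ℂ)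
    (hk : affineLift i w k ≠ 0) : ∃ c : ℂ,
    affineLin k (fderiv ℂ (fun w => affineCoord k
      (Projectivization.mk ℂ (affineLift i w) (affineLift_ne_zero i w))) w v) =
      (affineLift i w k)⁻¹ • affineLin i v + c • affineLift i w := by
  set φ : (Fin n → ℂ) → Fin n → ℂ := fun w => affineCoord k
      (Projectivization.mk ℂ (affineLift i w) (affineLift_ne_zero i w))
  have hA := hasFDerivAt_affineLift i w
  have hk' : HasFDerivAt (fun w => affineLift i w k)
      ((ContinuousLinearMap.proj k : (Fin (n + 1) → ℂ) →L[ℂ] ℂ).comp (affineLin i)) w :=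
    (ContinuousLinearMap.proj k : (Fin (n + 1) → ℂ) →L[ℂ] ℂ).hasFDerivAt.comp w hA
  have hev : ∀ᶠ u in 𝓝 w, affineLift i u k ≠ 0 := hk'.continuousAt.eventually_ne hk
  have hφd : DifferentiableAt ℂ φ w := by
    rw [differentiableAt_pi]
    intro j
    have hj : DifferentiableAt ℂ (fun w => affineLift i w (k.succAbove j)) w :=
      differentiableAt_pi.1 hA.differentiableAt (k.succAbove j)
    have hdiv : DifferentiableAt ℂ
        (fun w => affineLift i w (k.succAbove j) / affineLift i w k) w :=
      by simpa only [div_eq_mul_inv] using hj.fun_mul (hk'.differentiableAt.fun_inv hk)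
    exact hdiv
  -- Near w the lift of the new coordinates is z_k⁻¹ z. Comparing its two derivatives gives the
  -- formula; c is the derivative of z_k⁻¹ along v.
  have h1 := (hasFDerivAt_affineLift k (φ w)).comp w hφd.hasFDerivAt
  have h2 := ((hasDerivAt_inv hk).comp_hasFDerivAt w hk').smul hA
  have h3 := h1.unique (h2.congr_of_eventuallyEq (hev.mono fun u hu =>
    affineLift_affineCoord_mk k _ (affineLift_ne_zero i u) hu))
  refine ⟨-(affineLift i w k ^ 2)⁻¹ * affineLin i v k,
    (congrArg (fun T : (Fin n → ℂ) →L[ℂ] (Fin (n + 1) → ℂ) => T v) h3).trans ?_⟩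
  simp only [_root_.add_apply, _root_.smul_apply,
    ContinuousLinearMap.smulRight_apply, Function.comp_apply]
  rfl

end CProj

/-! ### Linear algebra in an affine chart -/

open CProj in
-- The triple product is a 3 × 3 determinant. As the entries in position k are 1, 0, 0, it reduces
-- up to sign to the 2 × 2 determinant of a and b.
theorem affineLift_cross_affineLin_dotProduct (k : Fin 3) (w a b : Fin 2 → ℂ)
    (h : (affineLift k w ⨯₃ affineLin k a) ⬝ᵥ affineLin k b = 0) : a 0 * b 1 = a 1 * b 0 := by
  have hz := affineLift_same k w
  have hz' := affineLift_succAbove k w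
  have ha := affineLin_same k a
  have ha' := affineLin_succAbove k a
  have hb := affineLin_same k b
  have hb' := affineLin_succAbove k b
  rw [cross_apply] at h
  simp only [Fin.forall_fin_two] at hz' ha' hb'
  generalize affineLift k w = z at *
  generalize affineLin k a = x at *
  generalize affineLin k b = y at *
  simp only [vec3_dotProduct] at h
  fin_cases k <;> simp [Fin.succAbove] at * <;>
    (rw [ha'.1, ha'.2, hb'.1, hb'.2, hz, ha, hb] at h) <;>
    first | linear_combination h | linear_combination -h

theorem exists_eq_smul_of_mul_eq_mul {K : Type*} [Field K] {a b : Fin 2 → K} (hb : b ≠ 0)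
    (h : a 0 * b 1 = a 1 * b 0) : ∃ c : K, a = c • b := by
  by_cases h0 : b 0 = 0
  · have h1 : b 1 ≠ 0 := fun h1 => hb (by funext i; fin_cases i <;> simp [h0, h1])
    refine ⟨a 1 / b 1, funext fun i => ?_⟩
    have : a 0 = 0 := by simpa [h0, h1] using h
    fin_cases i <;> simp [h0, h1, this]
  · refine ⟨a 0 / b 0, funext fun i => ?_⟩
    fin_cases i
    · simp [h0]
    · simp; field_simp; linear_combination -h

open CProj in
/-- At a smooth point of the curve, the kernel of the differential of the equation in an affine
chart is a line. -/
theorem IsSmoothPlaneCurveEquation.mul_eq_mul_of_polar_eq_zero {F : MvPolynomial (Fin 3) ℂ} {d : ℕ}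
    (hF : IsSmoothPlaneCurveEquation F d) (k : Fin 3) (w a b : Fin 2 → ℂ)
    (hw : eval (affineLift k w) F = 0) (ha : polar F (affineLift k w) (affineLin k a) = 0)
    (hb : polar F (affineLift k w) (affineLin k b) = 0) : a 0 * b 1 = a 1 * b 0 := by
  have hz := polar_self hF.isHomogeneous (affineLift k w)
  rw [hw, mul_zero] at hz
  obtain ⟨i, hi⟩ := hF.smooth _ (affineLift_ne_zero k w) hw
  simp only [polar, Fin.sum_univ_succAbove _ k, affineLin_same, affineLin_succAbove,
    affineLift_same, affineLift_succAbove, mul_zero, zero_add, mul_one, Fin.sum_univ_two]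
    at ha hb hz
  by_contra hab
  have hab' : a 0 * b 1 - a 1 * b 0 ≠ 0 := sub_ne_zero.2 hab
  set g := fun i => eval (affineLift k w) (pderiv i F)
  -- If a and b were independent, Cramer's rule would kill the two partial derivatives other than
  -- the k-th, and Euler's identity with z_k = 1 would kill the k-th.
  have e0 : g (k.succAbove 0) = 0 := by
    refine (mul_eq_zero.1 ?_).resolve_right hab'
    linear_combination b 1 * ha - a 1 * hb
  have e1 : g (k.succAbove 1) = 0 := by
    refine (mul_eq_zero.1 ?_).resolve_right hab'
    linear_combination a 0 * hb - b 0 * ha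
  have e2 : g k = 0 := by
    linear_combination hz - w 0 * e0 - w 1 * e1
  rcases Fin.eq_self_or_eq_succAbove k i with rfl | ⟨j, rfl⟩
  · exact hi e2
  · fin_cases j
    exacts [hi e0, hi e1]

/-! ### Compactness -/

namespace CProj

instance instCompactSpace {n : ℕ} : CompactSpace (CProj n) := by
  have hs : CompactSpace (Metric.sphere (0 : Fin (n + 1) → ℂ) 1) :=
    isCompact_iff_compactSpace.1 (isCompact_sphere _ _)
  let f : Metric.sphere (0 : Fin (n + 1) → ℂ) 1 → CProj n := fun v =>
    Projectivization.mk' ℂ ⟨v.1, ne_zero_of_mem_unit_sphere v⟩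
  have hf : Continuous f :=
    isQuotientMap_mk'.continuous.comp (continuous_subtype_val.subtype_mk _)
  suffices h : Function.Surjective f from h.compactSpace hf
  intro p
  induction p using Projectivization.ind with | h v hv =>
  have hv' : (‖v‖ : ℂ) ≠ 0 := by simpa using hv
  refine ⟨⟨(‖v‖ : ℂ)⁻¹ • v, ?_⟩, ?_⟩
  · simp [norm_smul, hv]
  · exact (Projectivization.mk_eq_mk_iff' ℂ _ _ _ _).2 ⟨(‖v‖ : ℂ)⁻¹, rfl⟩

end CProj

theorem mk_mem_planeCurve {F : MvPolynomial (Fin 3) ℂ} {d : ℕ} (hF : F.IsHomogeneous d)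
    (v : Fin 3 → ℂ) (hv : v ≠ 0) :
    (Projectivization.mk ℂ v hv : CProj 2) ∈ planeCurve F ↔ eval v F = 0 := by
  simp only [planeCurve, Set.mem_ofPred_eq, Projectivization.submodule_mk,
    Submodule.mem_span_singleton]
  constructor
  · exact fun h => h v ⟨1, one_smul _ _⟩
  · rintro h _ ⟨t, rfl⟩
    rw [hF.eval_smul, h, mul_zero]

theorem isClosed_planeCurve {F : MvPolynomial (Fin 3) ℂ} {d : ℕ} (hF : F.IsHomogeneous d) :
    IsClosed (planeCurve F) := by
  rw [← CProj.isQuotientMap_mk'.isClosed_preimage]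
  have : Projectivization.mk' ℂ ⁻¹' planeCurve F =
      {v : {v : Fin 3 → ℂ // v ≠ 0} | eval v.1 F = 0} := by
    ext v
    exact mk_mem_planeCurve hF v.1 v.2
  rw [this]
  exact isClosed_eq ((contDiff_eval F (n := 0)).continuous.comp continuous_subtype_val)
    continuous_const

/-! ### Immersions -/

/-- The derivative of an immersion is injective. -/
theorem Manifold.IsImmersionAt.mfderiv_injective {𝕜 E E' M N : Type*} [NontriviallyNormedField 𝕜]
    [NormedAddCommGroup E] [NormedSpace 𝕜 E] [NormedAddCommGroup E'] [NormedSpace 𝕜 E']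
    [TopologicalSpace M] [ChartedSpace E M] [TopologicalSpace N] [ChartedSpace E' N]
    {n : ℕ∞ω} {f : M → N} {x : M}
    (h : IsImmersionAt 𝓘(𝕜, E) 𝓘(𝕜, E') n f x) (hn : 1 ≤ n) :
    Function.Injective (mfderiv 𝓘(𝕜, E) 𝓘(𝕜, E') f x) := by
  let e := h.domChart
  let e' := h.codChart
  -- In the charts the immersion is y ↦ (y, 0) up to a linear equivalence, so projecting to the
  -- first factor gives a differentiable local left inverse.
  let L : E' →L[𝕜] E := (ContinuousLinearMap.fst 𝕜 E h.complement).comp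
    (h.equiv.symm : E' →L[𝕜] E × h.complement)
  have hgf : ∀ y ∈ e.source, e.symm (L (e' (f y))) = y := by
    intro y hy
    have := h.writtenInCharts
      (show e y ∈ (h.domChart.extend 𝓘(𝕜, E)).target by simpa using e.map_source hy)
    have h2 : e' (f y) = h.equiv (e y, 0) := by
      simpa [e.left_inv hy, e, e'] using this
    simp [L, h2, e.left_inv hy]
  have hx : x ∈ e.source := h.mem_domChart_source
  have hLx : L (e' (f x)) = e x := by
    have := h.writtenInCharts
      (show e x ∈ (h.domChart.extend 𝓘(𝕜, E)).target by simpa using e.map_source hx)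
    have h2 : e' (f x) = h.equiv (e x, 0) := by
      simpa [e.left_inv hx, e, e'] using this
    simp [L, h2]
  have h1 : MDifferentiableAt 𝓘(𝕜, E') 𝓘(𝕜, E') e' (f x) :=
    mdifferentiableAt_of_mem_maximalAtlas
      (IsManifold.maximalAtlas_subset_of_le hn h.codChart_mem_maximalAtlas) h.mem_codChart_source
  have h2 : MDifferentiableAt 𝓘(𝕜, E) 𝓘(𝕜, E) e.symm (L (e' (f x))) := by
    rw [hLx]
    exact mdifferentiableAt_symm_of_mem_maximalAtlas
      (IsManifold.maximalAtlas_subset_of_le hn h.domChart_mem_maximalAtlas) (e.map_source hx)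
  have h3 : MDifferentiableAt 𝓘(𝕜, E') 𝓘(𝕜, E) (fun y => e.symm (L (e' y))) (f x) :=
    h2.comp (f x) (L.mdifferentiableAt.comp (f x) h1)
  have h4 : MDifferentiableAt 𝓘(𝕜, E) 𝓘(𝕜, E') f x :=
    h.contMDiffAt.mdifferentiableAt (by rintro rfl; simp at hn)
  have h5 := mfderiv_comp x h3 h4
  have h6 : (fun y => e.symm (L (e' y))) ∘ f =ᶠ[𝓝 x] id :=
    Filter.eventually_of_mem (e.open_source.mem_nhds hx) hgf
  rw [h6.mfderiv_eq, mfderiv_id] at h5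
  intro u v huv
  have := congrArg (mfderiv 𝓘(𝕜, E') 𝓘(𝕜, E) (fun y => e.symm (L (e' y))) (f x)) huv
  change ((mfderiv 𝓘(𝕜, E') 𝓘(𝕜, E) (fun y => e.symm (L (e' y))) (f x)).comp
      (mfderiv 𝓘(𝕜, E) 𝓘(𝕜, E') f x)) u =
    ((mfderiv 𝓘(𝕜, E') 𝓘(𝕜, E) (fun y => e.symm (L (e' y))) (f x)).comp
      (mfderiv 𝓘(𝕜, E) 𝓘(𝕜, E') f x)) v at this
  rw [← h5] at this
  exact this

variable {C : Type*} [TopologicalSpace C] [ChartedSpace ℂ C] {ι : C → CProj 2}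

/-! ### Representatives in the preferred charts -/

namespace CProj

/-- The index of the preferred affine chart at a point. -/
noncomputable def chartIndex {n : ℕ} (p : CProj n) : Fin (n + 1) := (exists_mem_affineSet p).choose

theorem mem_affineSet_chartIndex {n : ℕ} (p : CProj n) : p ∈ affineSet (chartIndex p) :=
  (exists_mem_affineSet p).choose_spec

/-- The representative of a point with `k`-th coordinate `1`. -/
noncomputable def rep {n : ℕ} (k : Fin (n + 1)) (p : CProj n) : Fin (n + 1) → ℂ :=
  affineLift k (affineCoord k p)

/-- Passing from the preferred chart to the affine chart `k` in homogeneous coordinates. -/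
theorem rep_trivializationAt {n : ℕ} (p₀ p : CProj n) (v : TangentSpace 𝓘(ℂ, Fin n → ℂ) p)
    (hp : p ∈ affineSet (chartIndex p₀)) : ∃ t c : ℂ, t ≠ 0 ∧
    rep (chartIndex p₀) p = t • rep (chartIndex p) p ∧
    affineLin (chartIndex p₀) (trivializationAt (Fin n → ℂ) (TangentSpace 𝓘(ℂ, Fin n → ℂ)) p₀
      (⟨p, v⟩ : TangentBundle 𝓘(ℂ, Fin n → ℂ) (CProj n))).2 =
      t • affineLin (chartIndex p) v + c • rep (chartIndex p) p := by
  set k := chartIndex p₀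
  set i := chartIndex p
  have hpi : p ∈ affineSet i := mem_affineSet_chartIndex p
  have hmk := mk_affineLift_affineCoord i hpi
  have hk : affineLift i (affineCoord i p) k ≠ 0 := by
    rw [← hmk, mk_mem_affineSet] at hp
    exact hp
  obtain ⟨c, hc⟩ := affineLin_fderiv_coordChange i k (affineCoord i p) v hk
  refine ⟨(affineLift i (affineCoord i p) k)⁻¹, c, inv_ne_zero hk, ?_, ?_⟩
  · conv_lhs => rw [← hmk]
    exact affineLift_affineCoord_mk k _ (affineLift_ne_zero _ _) hk
  · rw [TangentBundle.trivializationAt_apply]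
    refine Eq.trans ?_ hc
    simp only [ModelWithCorners.range_eq_univ, fderivWithin_univ]
    rfl

end CProj

/-! ### The tangent line of a plane curve -/

open CProj

/-- The curve in the preferred affine chart at a point, with its velocity. -/
theorem hasDerivAt_affineCoord_comp_chart_symm {x : C}
    (h : MDifferentiableAt 𝓘(ℂ) 𝓘(ℂ, Fin 2 → ℂ) ι x) :
    HasDerivAt (fun t => affineCoord (chartIndex (ι x)) (ι ((chartAt ℂ x).symm t)))
      (mfderiv 𝓘(ℂ) 𝓘(ℂ, Fin 2 → ℂ) ι x (1 : ℂ) : Fin 2 → ℂ) (chartAt ℂ x x) := by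
  have h1 := h.hasMFDerivAt.2
  rw [ModelWithCorners.range_eq_univ] at h1
  have key (f : ℂ → Fin 2 → ℂ) (L : ℂ →L[ℂ] (Fin 2 → ℂ)) (t : ℂ)
      (hf : HasFDerivWithinAt f L Set.univ t) : HasDerivAt f (L 1) t :=
    (hf.hasFDerivAt Filter.univ_mem).hasDerivAt
  exact key _ _ _ h1

theorem hasDerivAt_rep_comp_chart_symm {x : C}
    (h : MDifferentiableAt 𝓘(ℂ) 𝓘(ℂ, Fin 2 → ℂ) ι x) :
    HasDerivAt (fun t => rep (chartIndex (ι x)) (ι ((chartAt ℂ x).symm t)))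
      (affineLin (chartIndex (ι x)) (mfderiv 𝓘(ℂ) 𝓘(ℂ, Fin 2 → ℂ) ι x (1 : ℂ)))
      (chartAt ℂ x x) :=
  (hasFDerivAt_affineLift _ _).comp_hasDerivAt _ (hasDerivAt_affineCoord_comp_chart_symm h)

theorem eval_rep {F : MvPolynomial (Fin 3) ℂ} {d : ℕ} (hF : F.IsHomogeneous d) {p : CProj 2}
    (hp : p ∈ planeCurve F) {k : Fin 3} (hk : p ∈ affineSet k) : eval (rep k p) F = 0 := by
  rw [← mk_affineLift_affineCoord k hk, mk_mem_planeCurve hF] at hp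
  exact hp

theorem eventually_chart_symm_mem {x : C} (h : ContinuousAt ι x) {s : Set C} (hs : s ∈ 𝓝 x) :
    ∀ᶠ t in 𝓝 (chartAt ℂ x x), (chartAt ℂ x).symm t ∈ s ∧
      ι ((chartAt ℂ x).symm t) ∈ affineSet (chartIndex (ι x)) := by
  have hc : Filter.Tendsto (chartAt ℂ x).symm (𝓝 (chartAt ℂ x x)) (𝓝 x) := by
    have := (chartAt ℂ x).continuousAt_symm ((chartAt ℂ x).map_source (mem_chart_source ℂ x))
    rwa [ContinuousAt, (chartAt ℂ x).left_inv (mem_chart_source ℂ x)] at this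
  exact (hc.eventually hs).and (hc.eventually (h
    ((isOpen_affineSet _).mem_nhds (mem_affineSet_chartIndex _))))

/-- The velocity of the curve is in the kernel of the differential of the equation. -/
theorem polar_mfderiv {F : MvPolynomial (Fin 3) ℂ} {d : ℕ} (hF : F.IsHomogeneous d)
    (hι : ∀ x, ι x ∈ planeCurve F) {x : C} (h : MDifferentiableAt 𝓘(ℂ) 𝓘(ℂ, Fin 2 → ℂ) ι x) :
    polar F (rep (chartIndex (ι x)) (ι x))
      (affineLin (chartIndex (ι x)) (mfderiv 𝓘(ℂ) 𝓘(ℂ, Fin 2 → ℂ) ι x (1 : ℂ))) = 0 := by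
  have h1 := hasDerivAt_eval F (hasDerivAt_rep_comp_chart_symm h)
  rw [(chartAt ℂ x).left_inv (mem_chart_source ℂ x)] at h1
  refine h1.unique ((hasDerivAt_const _ (0 : ℂ)).congr_of_eventuallyEq ?_)
  filter_upwards [eventually_chart_symm_mem h.continuousAt Filter.univ_mem] with t ht
  exact eval_rep hF (hι _) ht.2

/-- A tangent vector of the plane that is not tangent to the curve is not in the kernel of the
differential of the equation. -/
theorem polar_ne_zero_of_not_mem {F : MvPolynomial (Fin 3) ℂ} {d : ℕ}
    (hF : IsSmoothPlaneCurveEquation F d) (hι : ∀ x, ι x ∈ planeCurve F) {x : C}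
    (h : Function.Injective (mfderiv 𝓘(ℂ) 𝓘(ℂ, Fin 2 → ℂ) ι x))
    {v : TangentSpace 𝓘(ℂ, Fin 2 → ℂ) (ι x)} (hv : v ∉ curveTangentLine (Fin 2 → ℂ) ι x) :
    polar F (rep (chartIndex (ι x)) (ι x)) (affineLin (chartIndex (ι x)) v) ≠ 0 := by
  intro h0
  -- Without differentiability `mfderiv` is 0 by default, which is not injective on ℂ.
  have hd := mdifferentiableAt_of_mfderiv_injective h
  set b : Fin 2 → ℂ := mfderiv 𝓘(ℂ) 𝓘(ℂ, Fin 2 → ℂ) ι x (1 : ℂ)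
  have hb : b ≠ 0 := fun hb => one_ne_zero (α := ℂ) (h (hb.trans (map_zero _).symm))
  obtain ⟨c, hc⟩ := exists_eq_smul_of_mul_eq_mul hb
    (hF.mul_eq_mul_of_polar_eq_zero (chartIndex (ι x)) (affineCoord _ (ι x)) v b
      (eval_rep hF.isHomogeneous (hι x) (mem_affineSet_chartIndex _)) h0
      (polar_mfderiv hF.isHomogeneous hι hd))
  refine hv ⟨(c : ℂ), ?_⟩
  refine Eq.trans ?_ hc.symm
  have := (mfderiv 𝓘(ℂ) 𝓘(ℂ, Fin 2 → ℂ) ι x).map_smul c (1 : ℂ)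
  exact (congrArg (mfderiv 𝓘(ℂ) 𝓘(ℂ, Fin 2 → ℂ) ι x) (mul_one c).symm).trans this

/-! ### Line fields along a plane curve -/

theorem differentiableAt_normalizedLine_affineLift (F : MvPolynomial (Fin 3) ℂ) (k : Fin 3)
    {w a : Fin 2 → ℂ} (h : polar F (affineLift k w) (affineLin k a) ≠ 0) :
    DifferentiableAt ℂ (fun q : (Fin 2 → ℂ) × (Fin 2 → ℂ) =>
      normalizedLine F (affineLift k q.1) (affineLin k q.2)) (w, a) := by
  have h1 : DifferentiableAt ℂ (fun q : (Fin 2 → ℂ) × (Fin 2 → ℂ) => affineLift k q.1) (w, a) :=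
    (hasFDerivAt_affineLift k w).differentiableAt.comp (w, a) differentiableAt_fst
  have h2 : DifferentiableAt ℂ (fun q : (Fin 2 → ℂ) × (Fin 2 → ℂ) => affineLin k q.2) (w, a) :=
    (affineLin k).differentiableAt.comp (w, a) differentiableAt_snd
  have h3 : DifferentiableAt ℂ (fun q : (Fin 3 → ℂ) × (Fin 3 → ℂ) => normalizedLine F q.1 q.2)
      (affineLift k w, affineLin k a) :=
    (contDiffAt_normalizedLine (n := 1) F h).differentiableAt one_ne_zero
  exact h3.comp (w, a) (h1.prodMk h2)

theorem differentiableAt_pow_smul_normalizedLine (F : MvPolynomial (Fin 3) ℂ) (k j : Fin 3) (m : ℕ)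
    {w a : Fin 2 → ℂ} (h : polar F (affineLift k w) (affineLin k a) ≠ 0) :
    DifferentiableAt ℂ (fun q : (Fin 2 → ℂ) × (Fin 2 → ℂ) =>
      affineLift k q.1 j ^ m • normalizedLine F (affineLift k q.1) (affineLin k q.2)) (w, a) := by
  have h1 : DifferentiableAt ℂ (fun q : (Fin 2 → ℂ) × (Fin 2 → ℂ) => affineLift k q.1) (w, a) :=
    (hasFDerivAt_affineLift k w).differentiableAt.comp (w, a) differentiableAt_fst
  have h2 := differentiableAt_normalizedLine_affineLift F k h
  refine differentiableAt_pi.2 fun i => ?_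
  simp only [Pi.smul_apply, smul_eq_mul]
  have h3 : DifferentiableAt ℂ (fun q : (Fin 2 → ℂ) × (Fin 2 → ℂ) => affineLift k q.1 j) (w, a) :=
    differentiableAt_pi.1 h1 j
  have h4 : DifferentiableAt ℂ (fun q : (Fin 2 → ℂ) × (Fin 2 → ℂ) =>
      normalizedLine F (affineLift k q.1) (affineLin k q.2) i) (w, a) := differentiableAt_pi.1 h2 i
  exact (h3.fun_pow m).fun_mul h4

namespace HolomorphicLineField

variable (Y : HolomorphicLineField (Fin 2 → ℂ) ι)

/-- A generator of the line at a point. -/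
noncomputable def generator (x : C) : TangentSpace 𝓘(ℂ, Fin 2 → ℂ) (ι x) :=
  (Y.exists_local_generator x).choose_spec.2.2.choose x

theorem generator_spec (x : C) : Y.generator x ≠ 0 ∧ Y.line x = Submodule.span ℂ {Y.generator x} :=
  (Y.exists_local_generator x).choose_spec.2.2.choose_spec.2 x
    (Y.exists_local_generator x).choose_spec.2.1

theorem generator_notMem (hY : Y.IsTransverse) (x : C) :
    Y.generator x ∉ curveTangentLine (Fin 2 → ℂ) ι x := fun h => hY x <| by
  rw [IsTangentAt, (Y.generator_spec x).2]
  exact (Submodule.span_singleton_le_iff_mem _ _).2 h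

/-- The lines through the points of the curve in the directions of the line field, as covectors
normalised by the equation and by the homogeneous coordinate of index `j`. -/
noncomputable def covector (F : MvPolynomial (Fin 3) ℂ) (d : ℕ) (j : Fin 3) (x : C) : Fin 3 → ℂ :=
  rep (chartIndex (ι x)) (ι x) j ^ (d - 2) •
    normalizedLine F (rep (chartIndex (ι x)) (ι x)) (affineLin (chartIndex (ι x)) (Y.generator x))

/-- Neither the preferred chart nor the chosen generator need vary continuously with the point. They
may be replaced by one fixed chart and any spanning vector: a new representative t z contributes
t^(d-2) to the coordinate power, which cancels the t^(2-d) from `normalizedLine_smul`. -/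
theorem covector_eq {F : MvPolynomial (Fin 3) ℂ} {d : ℕ} (hF : F.IsHomogeneous d) (hd : 1 < d)
    (hι : ∀ x, ι x ∈ planeCurve F) (j : Fin 3) (x₀ x : C)
    (hx : ι x ∈ affineSet (chartIndex (ι x₀))) {v : TangentSpace 𝓘(ℂ, Fin 2 → ℂ) (ι x)}
    (hv0 : v ≠ 0) (hv : Y.line x = Submodule.span ℂ {v}) :
    Y.covector F d j x = rep (chartIndex (ι x₀)) (ι x) j ^ (d - 2) •
        normalizedLine F (rep (chartIndex (ι x₀)) (ι x)) (affineLin (chartIndex (ι x₀))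
          (trivializationAt (Fin 2 → ℂ) (TangentSpace 𝓘(ℂ, Fin 2 → ℂ)) (ι x₀)
          (⟨ι x, v⟩ : TangentBundle 𝓘(ℂ, Fin 2 → ℂ) (CProj 2))).2) := by
  obtain ⟨t, c, ht, h1, h2⟩ := rep_trivializationAt (ι x₀) (ι x) v hx
  obtain ⟨r, hr⟩ : ∃ r : ℂ, r • Y.generator x = v := by
    rw [← Submodule.mem_span_singleton, ← (Y.generator_spec x).2, hv]
    exact Submodule.mem_span_singleton_self v
  have hr0 : r ≠ 0 := by rintro rfl; exact hv0 (by rw [← hr, zero_smul])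
  have h3 : affineLin (chartIndex (ι x)) v = r • affineLin (chartIndex (ι x)) (Y.generator x) := by
    rw [← hr]; exact (affineLin (chartIndex (ι x))).map_smul r (Y.generator x)
  rw [h3, smul_smul] at h2
  rw [h2, h1, covector, ← normalizedLine_smul hF hd
    (eval_rep hF (hι x) (mem_affineSet_chartIndex (ι x))) ht (mul_ne_zero ht hr0) c, smul_smul]
  congr 1
  simp only [Pi.smul_apply, smul_eq_mul]
  ring

/-- Near a point the covector is a fixed expression in the chart coordinates of the curve and of a
holomorphic local generator; transversality keeps its denominator nonzero. -/
theorem mdifferentiable_covector {F : MvPolynomial (Fin 3) ℂ} {d : ℕ}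
    (hF : IsSmoothPlaneCurveEquation F d) (hd : 1 < d) (hι : ∀ x, ι x ∈ planeCurve F)
    (hinj : ∀ x, Function.Injective (mfderiv 𝓘(ℂ) 𝓘(ℂ, Fin 2 → ℂ) ι x))
    (hY : Y.IsTransverse) (j : Fin 3) :
    MDifferentiable 𝓘(ℂ) 𝓘(ℂ, Fin 3 → ℂ) (Y.covector F d j) := by
  intro x₀
  obtain ⟨U, hU, hxU, v, hv, hvY⟩ := Y.exists_local_generator x₀
  set k := chartIndex (ι x₀) with hk
  have hιd : MDifferentiableAt 𝓘(ℂ) 𝓘(ℂ, Fin 2 → ℂ) ι x₀ :=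
    mdifferentiableAt_of_mfderiv_injective (hinj x₀)
  have hnear : ∀ᶠ x in 𝓝 x₀, x ∈ U ∧ ι x ∈ affineSet k :=
    (hU.eventually_mem hxU).and (hιd.continuousAt.eventually
      ((isOpen_affineSet _).mem_nhds (mem_affineSet_chartIndex _)))
  let a : C → Fin 2 → ℂ := fun x =>
    (trivializationAt (Fin 2 → ℂ) (TangentSpace 𝓘(ℂ, Fin 2 → ℂ)) (ι x₀)
      (⟨ι x, v x⟩ : TangentBundle 𝓘(ℂ, Fin 2 → ℂ) (CProj 2))).2
  have ha : MDifferentiableAt 𝓘(ℂ) 𝓘(ℂ, Fin 2 → ℂ) a x₀ :=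
    (Bundle.contMDiffAt_totalSpace.1
      (hv.contMDiffAt (hU.mem_nhds hxU))).2.mdifferentiableAt (by simp)
  have hw : MDifferentiableAt 𝓘(ℂ) 𝓘(ℂ, Fin 2 → ℂ) (fun x => affineCoord k (ι x)) x₀ :=
    (mdifferentiableAt_atlas (chart_mem_atlas (Fin 2 → ℂ) (ι x₀))
      (mem_chart_source _ _)).comp x₀ hιd
  let G : (Fin 2 → ℂ) × (Fin 2 → ℂ) → Fin 3 → ℂ := fun q =>
    affineLift k q.1 j ^ (d - 2) • normalizedLine F (affineLift k q.1) (affineLin k q.2)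
  have hGeq : Y.covector F d j =ᶠ[𝓝 x₀] fun x => G (affineCoord k (ι x), a x) := by
    filter_upwards [hnear] with x hx
    exact Y.covector_eq hF.isHomogeneous hd hι j x₀ x hx.2
      (hvY x hx.1).1 (hvY x hx.1).2
  have hpol : polar F (affineLift k (affineCoord k (ι x₀))) (affineLin k (a x₀)) ≠ 0 := by
    have hgen : v x₀ ∉ curveTangentLine (Fin 2 → ℂ) ι x₀ := fun h => hY x₀ <| by
      rw [IsTangentAt, (hvY x₀ hxU).2]
      exact (Submodule.span_singleton_le_iff_mem _ _).2 h
    have := polar_ne_zero_of_not_mem hF hι (hinj x₀) hgen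
    -- At the base point of the trivialisation the coordinate change is the identity.
    have hax : a x₀ = v x₀ := (tangentBundleCore 𝓘(ℂ, Fin 2 → ℂ) (CProj 2)).coordChange_self
      (achart _ (ι x₀)) (ι x₀) (mem_achart_source _ _) (v x₀)
    rwa [hax]
  have hG : DifferentiableAt ℂ G (affineCoord k (ι x₀), a x₀) :=
    differentiableAt_pow_smul_normalizedLine F k j (d - 2) hpol
  refine MDifferentiableAt.congr_of_eventuallyEq ?_ hGeq
  exact hG.mdifferentiableAt.comp x₀ (hw.prodMk_space ha)

theorem covector_dotProduct_rep (F : MvPolynomial (Fin 3) ℂ) (d : ℕ)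
    (j : Fin 3) (x₀ x : C) (hx : ι x ∈ affineSet (chartIndex (ι x₀))) :
    Y.covector F d j x ⬝ᵥ rep (chartIndex (ι x₀)) (ι x) = 0 := by
  -- Only the proportionality of the representatives matters here, so the tangent vector is taken to
  -- be 0.
  obtain ⟨t, _, _, h, _⟩ := rep_trivializationAt (ι x₀) (ι x) 0 hx
  rw [h, covector, smul_dotProduct, dotProduct_smul, normalizedLine_dotProduct, smul_zero,
    smul_zero]

end HolomorphicLineField

end PlaneCurveLineField

open Matrix CProj in
/-- Let `F` be an equation of degree `d > 1` of a smooth plane curve and let `ι` be a holomorphic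
embedding of a Riemann surface `C` into the projective plane with image that curve. Then no
holomorphic line field along `C` is transverse to `C`. -/
theorem mainTheorem8 (d : ℕ) (hd : 1 < d) (F : MvPolynomial (Fin 3) ℂ)
    (hF : IsSmoothPlaneCurveEquation F d)
    (C : Type*) [TopologicalSpace C] [ChartedSpace ℂ C] [IsManifold 𝓘(ℂ) ω C]
    (ι : C → CProj 2)
    (hι : Manifold.IsSmoothEmbedding 𝓘(ℂ) 𝓘(ℂ, Fin 2 → ℂ) ω ι)
    (hC : Set.range ι = planeCurve F) :
    ¬ ∃ Y : HolomorphicLineField (Fin 2 → ℂ) ι, Y.IsTransverse := by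
  rintro ⟨Y, hY⟩
  have hmem (x : C) : ι x ∈ planeCurve F := hC ▸ Set.mem_range_self x
  have hinj (x : C) : Function.Injective (mfderiv 𝓘(ℂ) 𝓘(ℂ, Fin 2 → ℂ) ι x) :=
    (hι.isImmersion.isImmersionAt x).mfderiv_injective le_top
  have : CompactSpace C := Topology.IsClosedEmbedding.compactSpace (f := ι)
    ⟨hι.isEmbedding, hC ▸ isClosed_planeCurve hF.isHomogeneous⟩
  obtain ⟨x₀⟩ : Nonempty C := by
    obtain ⟨v, hv, h0⟩ := hF.isHomogeneous.exists_eval_eq_zero (by omega)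
    have h := (mk_mem_planeCurve hF.isHomogeneous v hv).2 h0
    rw [← hC] at h
    exact ⟨h.choose⟩
  have hιd := mdifferentiableAt_of_mfderiv_injective (hinj x₀)
  set k := chartIndex (ι x₀) with hk
  set b : Fin 2 → ℂ := mfderiv 𝓘(ℂ) 𝓘(ℂ, Fin 2 → ℂ) ι x₀ (1 : ℂ)
  have hb : b ≠ 0 := fun hb => one_ne_zero (α := ℂ) (hinj x₀ (hb.trans (map_zero _).symm))
  -- The line through the points of the curve near `x₀` is constant.
  have hconst :=
    (Y.mdifferentiable_covector hF hd hmem hinj hY k).isLocallyConstant.eventually_eq x₀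
  have hderiv : Y.covector F d k x₀ ⬝ᵥ affineLin k b = 0 := by
    have h1 : HasDerivAt
        (fun t => Y.covector F d k x₀ ⬝ᵥ rep k (ι ((chartAt ℂ x₀).symm t)))
        (Y.covector F d k x₀ ⬝ᵥ affineLin k b) (chartAt ℂ x₀ x₀) := by
      simp only [dotProduct]
      exact HasDerivAt.fun_sum fun i _ =>
        (hasDerivAt_pi.1 (hasDerivAt_rep_comp_chart_symm hιd) i).const_mul _
    refine h1.unique ((hasDerivAt_const _ (0 : ℂ)).congr_of_eventuallyEq ?_)
    filter_upwards [eventually_chart_symm_mem hιd.continuousAt hconst] with t ht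
    -- The constant covector is also the covector at the nearby point, and that one annihilates the
    -- representative of the nearby point.
    rw [← ht.1]
    exact Y.covector_dotProduct_rep F d k x₀ _ ht.2
  -- Hence the line at `x₀` is tangent to the curve.
  have hpol := polar_ne_zero_of_not_mem hF hmem (hinj x₀) (Y.generator_notMem hY x₀)
  rw [HolomorphicLineField.covector, normalizedLine, smul_dotProduct, smul_dotProduct,
    smul_eq_zero, smul_eq_zero] at hderiv
  -- The coordinate power is 1, since k indexes the preferred chart at x₀ and the representative
  -- there has k-th entry 1.
  have hcross := (hderiv.resolve_left (by simp [rep, ← hk])).resolve_left (inv_ne_zero hpol)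
  obtain ⟨c, hc⟩ := exists_eq_smul_of_mul_eq_mul hb
    (affineLift_cross_affineLin_dotProduct k (affineCoord k (ι x₀)) (Y.generator x₀) b hcross)
  refine hpol ?_
  rw [hc, map_smul]
  have := polar_add_smul F (rep k (ι x₀)) (affineLin k b) 0 c 0
  rw [smul_zero, add_zero, zero_mul, add_zero, polar_mfderiv hF.isHomogeneous hmem hιd,
    mul_zero] at this
  exact this
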